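/- Let $k\ge 1$ and $n_1,\dots,n_k\ge 1$ be integers. For each $i$ let $\mathbb F_{n_i}^+$ be the free unital semigroup on $n_i$ generators $g^i_1,\dots,g^i_{n_i}$ (words, with length $|\cdot|$), and let $q_i=\sum_{\alpha}a_{i,\alpha}Z_\alpha$ be a positive regular polynomial in $n_i$ noncommuting indeterminates: finitely many nonzero coefficients, all $a_{i,\alpha}\ge 0$, zero constant term, and nonzero coefficients of all linear terms. Put $b_{i,\emptyset}:=1$ and $$b_{i,\alpha}:=\sum_{p=1}^{|\alpha|}\ \sum_{\gamma_1\cdots\gamma_p=\alpha,\ |\gamma_j|\ge 1}a_{i,\gamma_1}\cdots a_{i,\gamma_p}\qquad(|\alpha|\ge 1).$$ For a complex Hilbert space $\mathcal H$ and $X=(X_1,\dots,X_k)$ with $X_i=(X_{i,1},\dots,X_{i,n_i})\in B(\mathcal H)^{n_i}$, write $X_{i,\alpha}:=X_{i,j_1}\cdots X_{i,j_p}$ for $\alpha=g^i_{j_1}\cdots g^i_{j_p}$, $X_{\boldsymbol\alpha}:=X_{1,\alpha_1}\cdots X_{k,\alpha_k}$ for $\boldsymbol\alpha=(\alpha_1,\dots,\alpha_k)\in\mathbb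 F_{n_1}^+\times\cdots\times\mathbb F_{n_k}^+$, and $\Phi_{q_i,X_i}(T):=\sum_\alpha a_{i,\alpha}X_{i,\alpha}TX_{i,\alpha}^*$. Let $\mathbf D_{\mathbf q}(\mathcal H)^-$ be the closed regular polydomain, i.e. the set of all $X$ such that the entries of $X_s$ commute with the entries of $X_t$ whenever $s\ne t$, and $$(\mathrm{id}-\Phi_{q_1,X_1})^{p_1}\circ\cdots\circ(\mathrm{id}-\Phi_{q_k,X_k})^{p_k}(I)\ge 0\qquad\text{for all }(p_1,\dots,p_k)\in\{0,1\}^k.$$ Let $\mathcal K$ be a complex Hilbert space and let $A_{(\boldsymbol\alpha)}\in B(\mathcal K)$ for $\boldsymbol\alpha\in\mathbb F_{n_1}^+\times\cdots\times\mathbb F_{n_k}^+$ be the coefficients of a formal power series $\psi=\sum_{\boldsymbol\alpha}A_{(\boldsymbol\alpha)}\otimes Z_{\boldsymbol\alpha}$. Let $\gamma\in[0,\infty]$ be its polydomain radius of convergence, $$\frac1\gamma:=\limsup_{\mathbf p\in\mathbb Z_+^k}\Big\|\sum_{|\alpha_i|=p_i,\ 1\le i\le k}\frac{1}{b_{1,\alpha_1}\cdots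 b_{k,\alpha_k}}A_{(\boldsymbol\alpha)}^*A_{(\boldsymbol\alpha)}\Big\|^{\frac1{2(p_1+\cdots+p_k)}},$$ the upper limit being taken along the complements of finite subsets of $\mathbb Z_+^k$, with $1/0=\infty$ and $1/\infty=0$. Write $\Gamma_m:=\{\boldsymbol\alpha:\ |\alpha_1|+\cdots+|\alpha_k|=m\}$; operators $A_{(\boldsymbol\alpha)}\otimes X_{\boldsymbol\alpha}$ act on the Hilbert space tensor product $\mathcal K\otimes\mathcal H$. Then: (i) if $0\le r<\gamma$, then for every Hilbert space $\mathcal H$ the series $\displaystyle\sum_{m=0}^\infty\Big\|\sum_{\boldsymbol\alpha\in\Gamma_m}A_{(\boldsymbol\alpha)}\otimes X_{\boldsymbol\alpha}\Big\|$ converges uniformly for $X\in r\,\mathbf D_{\mathbf q}(\mathcal H)^-$; (ii) for every real $s>\gamma$ there are a Hilbert space $\mathcal H$ and $Y\in s\,\mathbf D_{\mathbf q}(\mathcal H)^-$ such that the series $\displaystyle\sum_{m=0}^\infty\ \sum_{\boldsymbol\alpha\in\Gamma_m}A_{(\boldsymbol\alpha)}\otimes Y_{\boldsymbol\alpha}$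 diverges in the operator norm. -/

import Mathlib

open Filter Topology
open scoped NNReal ENNReal TensorProduct Pointwise

noncomputable section

namespace Polydomain

/-- The words `α ∈ 𝔽⁺_N` of the free unital semigroup on `N` generators. -/
abbrev Word (N : ℕ) : Type := FreeMonoid (Fin N)

/-- The multi-words `(α₁, …, α_k) ∈ 𝔽⁺_{n₁} × ⋯ × 𝔽⁺_{n_k}`. -/
abbrev MultiWord {k : ℕ} (n : Fin k → ℕ) : Type := ∀ i : Fin k, Word (n i)

/-- The polynomials in `N` noncommuting indeterminates with real coefficients. -/
abbrev NCPoly (N : ℕ) : Type := MonoidAlgebra ℝ (Word N)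

/-- Positive regular polynomials: all coefficients are nonnegative, the constant term is zero,
and the coefficients of the linear terms are different from zero. -/
structure IsPositiveRegular {N : ℕ} (q : NCPoly N) : Prop where
  nonneg : ∀ α : Word N, 0 ≤ q.coeff α
  constant_eq_zero : q.coeff 1 = 0
  linear_ne_zero : ∀ j : Fin N, q.coeff (FreeMonoid.of j) ≠ 0

/-- The weights `b_α`. The coefficient of `α` in `q ^ p` is the sum of
`a_{γ₁} ⋯ a_{γ_p}` over all factorizations `α = γ₁ ⋯ γ_p`; since the constant term of a positive
regular polynomial vanishes, only factorizations into nonempty words contribute. The term `p = 0`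
is `1` for the empty word and `0` for every other word. -/
def weight {N : ℕ} (q : NCPoly N) (α : Word N) : ℝ :=
  ∑ p ∈ Finset.range (α.length + 1), (q ^ p).coeff α

/-- There are finitely many multi-words of bounded multi-length. -/
theorem finite_length_le {k : ℕ} (n : Fin k → ℕ) (p : Fin k → ℕ) :
    {α : MultiWord n | ∀ i, (α i).length ≤ p i}.Finite := by
  have h : ∀ i, {α : Word (n i) | α.length ≤ p i}.Finite := fun i =>
    List.finite_length_le (Fin (n i)) (p i)
  refine (Set.Finite.pi' h).subset ?_
  intro α hα i
  exact hα i

theorem finite_multidegree {k : ℕ} (n : Fin k → ℕ) (p : Fin k → ℕ) :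
    {α : MultiWord n | ∀ i, (α i).length = p i}.Finite :=
  (finite_length_le n p).subset fun _ hα i => (hα i).le

theorem finite_totalDegree {k : ℕ} (n : Fin k → ℕ) (m : ℕ) :
    {α : MultiWord n | ∑ i, (α i).length = m}.Finite := by
  refine (finite_length_le n fun _ => m).subset ?_
  intro α hα i
  have hα' : ∑ i, (α i).length = m := hα
  rw [← hα']
  exact Finset.single_le_sum (f := fun i => (α i).length) (fun _ _ => Nat.zero_le _)
    (Finset.mem_univ i)

/-- `Λ_p`, the multi-words with `|α_i| = p_i` for every `i`. -/
def multidegree {k : ℕ} (n : Fin k → ℕ) (p : Fin k → ℕ) : Finset (MultiWord n) :=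
  (finite_multidegree n p).toFinset

/-- `Γ_m`, the multi-words with `|α₁| + ⋯ + |α_k| = m`. -/
def totalDegree {k : ℕ} (n : Fin k → ℕ) (m : ℕ) : Finset (MultiWord n) :=
  (finite_totalDegree n m).toFinset

section Operators

variable {H : Type*} [NormedAddCommGroup H] [InnerProductSpace ℂ H]

/-- Elements of `B(H)^{n₁} × ⋯ × B(H)^{n_k}`. -/
abbrev OpTuple {k : ℕ} (n : Fin k → ℕ) (H : Type*) [NormedAddCommGroup H]
    [InnerProductSpace ℂ H] : Type _ :=
  ∀ i : Fin k, Fin (n i) → (H →L[ℂ] H)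

/-- `X_α = X_{j₁} ⋯ X_{j_p}` for a word `α = g_{j₁} ⋯ g_{j_p}`. -/
def evalWord {N : ℕ} (X : Fin N → (H →L[ℂ] H)) (α : Word N) : H →L[ℂ] H :=
  FreeMonoid.lift X α

/-- `X_α = X_{1,α₁} ⋯ X_{k,α_k}`, the factors being multiplied in this order. -/
def evalMultiWord {k : ℕ} {n : Fin k → ℕ} (X : OpTuple n H) (α : MultiWord n) : H →L[ℂ] H :=
  (List.ofFn fun i => evalWord (X i) (α i)).prod

variable [CompleteSpace H]

/-- The map `Φ_{q,X}(Y) = ∑_α a_α X_α Y X_α^*` on `B(H)`. -/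
def Phi {N : ℕ} (q : NCPoly N) (X : Fin N → (H →L[ℂ] H)) : Module.End ℂ (H →L[ℂ] H) :=
  q.coeff.sum fun α a =>
    (a : ℂ) • LinearMap.mulLeftRight ℂ
      (evalWord X α, ContinuousLinearMap.adjoint (evalWord X α))

/-- The defect mapping `Δ^p_{q,X} = (id - Φ_{q₁,X₁})^{p₁} ∘ ⋯ ∘ (id - Φ_{q_k,X_k})^{p_k}`. -/
def defect {k : ℕ} {n : Fin k → ℕ} (q : ∀ i, NCPoly (n i)) (X : OpTuple n H)
    (p : Fin k → ℕ) : Module.End ℂ (H →L[ℂ] H) :=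
  (List.ofFn fun i => (1 - Phi (q i) (X i)) ^ p i).prod

/-- The closed regular polydomain in `B(H)^{n₁} ×_c ⋯ ×_c B(H)^{n_k}`: the tuples whose entries
`X_{s,i}`, `X_{t,j}` commute for `s ≠ t`, and for which `Δ^p_{q,X}(I) ≥ 0` for every
`p ∈ {0,1}^k`. -/
def closedPolydomain {k : ℕ} {n : Fin k → ℕ} (q : ∀ i, NCPoly (n i)) (H : Type*)
    [NormedAddCommGroup H] [InnerProductSpace ℂ H] [CompleteSpace H] : Set (OpTuple n H) :=
  {X | (∀ s t : Fin k, s ≠ t → ∀ i j, Commute (X s i) (X t j)) ∧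
    ∀ p : Fin k → ℕ, (∀ i, p i ≤ 1) → (defect q X p 1).IsPositive}

end Operators

section Series

variable {K : Type*} [NormedAddCommGroup K] [InnerProductSpace ℂ K]
variable {H : Type*} [NormedAddCommGroup H] [InnerProductSpace ℂ H]

/-- The Hilbert space tensor product: the completion of the algebraic tensor product with
`⟪x ⊗ y, x' ⊗ y'⟫ = ⟪x, x'⟫ ⟪y, y'⟫`. -/
abbrev HilbertTensor (K H : Type*) [NormedAddCommGroup K] [InnerProductSpace ℂ K]
    [NormedAddCommGroup H] [InnerProductSpace ℂ H] : Type _ :=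
  UniformSpace.Completion (K ⊗[ℂ] H)

/-- The bounded operator `A ⊗ X` on the Hilbert space tensor product. -/
def opTensor (A : K →L[ℂ] K) (X : H →L[ℂ] H) : HilbertTensor K H →L[ℂ] HilbertTensor K H :=
  (TensorProduct.mapL A X).completion

/-- The homogeneous part `∑_{α ∈ Γ_m} A_α ⊗ X_α`. -/
def homogeneousPart {k : ℕ} {n : Fin k → ℕ} (A : MultiWord n → (K →L[ℂ] K)) (m : ℕ)
    (X : OpTuple n H) : HilbertTensor K H →L[ℂ] HilbertTensor K H :=
  ∑ α ∈ totalDegree n m, opTensor (A α) (evalMultiWord X α)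

variable [CompleteSpace K]

/-- `∑_{α ∈ Λ_p} (b_{1,α₁} ⋯ b_{k,α_k})⁻¹ A_α^* A_α`. -/
def weightedSquare {k : ℕ} {n : Fin k → ℕ} (q : ∀ i, NCPoly (n i))
    (A : MultiWord n → (K →L[ℂ] K)) (p : Fin k → ℕ) : K →L[ℂ] K :=
  ∑ α ∈ multidegree n p,
    (((∏ i, weight (q i) (α i))⁻¹ : ℝ) : ℂ) • (ContinuousLinearMap.adjoint (A α) * A α)

/-- The polydomain radius of convergence `γ ∈ [0, ∞]` of `∑ A_α ⊗ Z_α`, where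
`1 / γ` is the upper limit, over `p ∈ ℤ₊^k` (along the complements of finite sets), of
`‖∑_{α ∈ Λ_p} (b_{1,α₁} ⋯ b_{k,α_k})⁻¹ A_α^* A_α‖ ^ (1 / (2 (p₁ + ⋯ + p_k)))`. -/
def radius {k : ℕ} {n : Fin k → ℕ} (q : ∀ i, NCPoly (n i))
    (A : MultiWord n → (K →L[ℂ] K)) : ℝ≥0∞ :=
  (limsup (fun p : Fin k → ℕ =>
    ENNReal.ofReal (‖weightedSquare q A p‖ ^ (1 / (2 * ((∑ i, p i : ℕ) : ℝ))))) cofinite)⁻¹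

end Series

end Polydomain

end

/-! Both halves compare `‖homogeneousPart A m X‖` with the numbers `√‖weightedSquare q A p‖`, where
`p` has total degree `m`.

Upper bound. The weights satisfy b_ω = ∑_{βα = ω} a_β b_α for ω ≠ 1. Positivity of the defects with
exponents e_i says Φ_{q_i,X_i}(I) ≤ I; iterating along the recursion and composing over i gives ∑_{α
∈ Λ_p} b_α X_α X_α^* ≤ I, with b_α = ∏ b_{i,α_i}. Factoring A ⊗ X = (1 ⊗ X)(A ⊗ 1), a
row-times-column Cauchy–Schwarz inequality (`norm_sum_mul_le`) bounds the part of multidegree p by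
`√‖weightedSquare q A p‖`. Homogeneity, a root test over ℤ₊^k and the Weierstrass M-test give (i).

Lower bound. The weighted left creation operators W on ℓ² of the multi-words lie in the polydomain:
by the same recursion, id - Φ_{q_i,W_i} cuts diagonals down to α_i = 1
(`IsWeightedCreation.Phi_diagonal_apply`), so all defects are projections. Since W_α e_1 =
b_α^{-1/2} e_α, applying the homogeneous part to x ⊗ e_1 yields an orthogonal sum, whence
`√‖weightedSquare q A p‖ ≤ ‖homogeneousPart A m W‖`. For s > γ the terms of the series at sW do not
tend to zero, which gives (ii). -/

namespace Polydomain

noncomputable section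

/-! ### The weights b_α and their recursion -/

section Weights

variable {N : ℕ} {q : NCPoly N}

theorem coeff_mul_eq_sum (q x : NCPoly N) (ω : Word N) :
    (q * x).coeff ω =
      ∑ β ∈ q.coeff.support, (MonoidAlgebra.single β (q.coeff β) * x).coeff ω := by
  conv_lhs => rw [← MonoidAlgebra.sum_coeff_single q]
  rw [Finsupp.sum, Finset.sum_mul, MonoidAlgebra.coeff_sum, Finsupp.finsetSum_apply]

theorem IsPositiveRegular.ne_one (hq : IsPositiveRegular q) {β : Word N}
    (hβ : β ∈ q.coeff.support) : β ≠ 1 := by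
  rintro rfl
  exact Finsupp.mem_support_iff.1 hβ hq.constant_eq_zero

theorem length_pos_of_ne_one {β : Word N} (hβ : β ≠ 1) : 0 < β.length :=
  Nat.pos_of_ne_zero fun h => hβ (FreeMonoid.length_eq_zero.1 h)

/-- The constant term vanishes, so each of the p factors of a word contributes length at least one.
-/
theorem IsPositiveRegular.coeff_pow_eq_zero (hq : IsPositiveRegular q) (p : ℕ) (ω : Word N)
    (h : ω.length < p) : (q ^ p).coeff ω = 0 := by
  induction p generalizing ω with
  | zero => omega
  | succ p ih =>
    rw [pow_succ', coeff_mul_eq_sum]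
    refine Finset.sum_eq_zero fun β hβ => ?_
    by_cases hω : ∃ α, β * α = ω
    · obtain ⟨α, rfl⟩ := hω
      have := length_pos_of_ne_one (hq.ne_one hβ)
      rw [FreeMonoid.length_mul] at h
      rw [MonoidAlgebra.coeff_single_mul_mul, ih α (by omega), mul_zero]
    · push Not at hω
      exact MonoidAlgebra.coeff_single_mul_of_forall_mul_ne _ _ hω

theorem IsPositiveRegular.coeff_pow_nonneg (hq : IsPositiveRegular q) (p : ℕ) (ω : Word N) :
    0 ≤ (q ^ p).coeff ω := by
  induction p generalizing ω with
  | zero =>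
    classical
    rw [pow_zero, MonoidAlgebra.one_def, MonoidAlgebra.coeff_single, Finsupp.single_apply]
    split_ifs <;> norm_num
  | succ p ih =>
    rw [pow_succ', coeff_mul_eq_sum]
    refine Finset.sum_nonneg fun β hβ => ?_
    by_cases hω : ∃ α, β * α = ω
    · obtain ⟨α, rfl⟩ := hω
      rw [MonoidAlgebra.coeff_single_mul_mul]
      exact mul_nonneg (hq.nonneg β) (ih α)
    · push Not at hω
      exact (MonoidAlgebra.coeff_single_mul_of_forall_mul_ne _ _ hω).ge

theorem IsPositiveRegular.weight_nonneg (hq : IsPositiveRegular q) (ω : Word N) :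
    0 ≤ weight q ω :=
  Finset.sum_nonneg fun p _ => hq.coeff_pow_nonneg p ω

theorem weight_one (q : NCPoly N) : weight q 1 = 1 := by
  simp [weight]

/-- The freedom in the truncation `M` allows a word and its tails to be compared in one truncated
geometric series of `q`. -/
theorem IsPositiveRegular.weight_eq_coeff_sum (hq : IsPositiveRegular q) {ω : Word N} {M : ℕ}
    (hM : ω.length < M) : weight q ω = (∑ p ∈ Finset.range M, q ^ p).coeff ω := by
  rw [MonoidAlgebra.coeff_sum, Finsupp.finsetSum_apply, weight]
  refine Finset.sum_subset (fun p hp => ?_) fun p _ hp => hq.coeff_pow_eq_zero p ω ?_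
  · simp only [Finset.mem_range] at hp ⊢; omega
  · simp only [Finset.mem_range] at hp; omega

open Classical in
/-- The weight `b_α` if `ω = β α`, and zero if `β` is not a prefix of `ω`. -/
def tailWeight (q : NCPoly N) (β ω : Word N) : ℝ :=
  if h : ∃ α, β * α = ω then weight q h.choose else 0

theorem tailWeight_mul (q : NCPoly N) (β α : Word N) : tailWeight q β (β * α) = weight q α := by
  have h : ∃ α', β * α' = β * α := ⟨α, rfl⟩
  rw [tailWeight, dif_pos h, mul_left_cancel h.choose_spec]

theorem tailWeight_of_forall_ne {β ω : Word N} (h : ∀ α, β * α ≠ ω) :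
    tailWeight q β ω = 0 :=
  dif_neg fun ⟨α, hα⟩ => h α hα

/-- The recursion `b_ω = ∑_{βα = ω} a_β b_α`. -/
theorem IsPositiveRegular.weight_eq_sum (hq : IsPositiveRegular q) {ω : Word N} (hω : ω ≠ 1) :
    weight q ω = ∑ β ∈ q.coeff.support, q.coeff β * tailWeight q β ω := by
  classical
  rw [hq.weight_eq_coeff_sum (M := ω.length + 1) (by omega), Finset.sum_range_succ',
    MonoidAlgebra.coeff_add, Finsupp.add_apply, pow_zero, MonoidAlgebra.one_def,
    MonoidAlgebra.coeff_single, Finsupp.single_apply, if_neg (Ne.symm hω), add_zero]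
  -- Split off one factor `q` on the left. A tail of ω after a nonempty prefix is shorter than ω, so
  -- the remaining truncation at `ω.length` still computes its weight.
  simp_rw [pow_succ']
  rw [← Finset.mul_sum, coeff_mul_eq_sum]
  refine Finset.sum_congr rfl fun β hβ => ?_
  by_cases h : ∃ α, β * α = ω
  · obtain ⟨α, rfl⟩ := h
    have := length_pos_of_ne_one (hq.ne_one hβ)
    rw [MonoidAlgebra.coeff_single_mul_mul, tailWeight_mul, ← hq.weight_eq_coeff_sum]
    rw [FreeMonoid.length_mul]; omega
  · push Not at h
    rw [MonoidAlgebra.coeff_single_mul_of_forall_mul_ne _ _ h, tailWeight_of_forall_ne h,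
      mul_zero]

theorem IsPositiveRegular.tailWeight_nonneg (hq : IsPositiveRegular q) (β ω : Word N) :
    0 ≤ tailWeight q β ω := by
  unfold tailWeight
  split_ifs
  exacts [hq.weight_nonneg _, le_rfl]

/-- A single term of the nonnegative recursion. It yields positivity of the weights and, later,
boundedness of the creation operators. -/
theorem IsPositiveRegular.coeff_mul_weight_le (hq : IsPositiveRegular q) {β : Word N}
    (hβ : β ∈ q.coeff.support) (α : Word N) :
    q.coeff β * weight q α ≤ weight q (β * α) := by
  have h1 : β * α ≠ 1 := fun h => by
    have h2 := length_pos_of_ne_one (hq.ne_one hβ)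
    have h3 := congrArg FreeMonoid.length h
    rw [FreeMonoid.length_mul, FreeMonoid.length_one] at h3
    omega
  rw [hq.weight_eq_sum h1, ← tailWeight_mul q β α]
  exact Finset.single_le_sum (f := fun γ => q.coeff γ * tailWeight q γ (β * α))
    (fun γ _ => mul_nonneg (hq.nonneg γ) (hq.tailWeight_nonneg _ _)) hβ

theorem IsPositiveRegular.weight_pos (hq : IsPositiveRegular q) (ω : Word N) :
    0 < weight q ω := by
  induction ω using FreeMonoid.recOn with
  | one => rw [weight_one]; exact one_pos
  | of_mul j α h =>
    refine lt_of_lt_of_le (mul_pos ?_ h)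
      (hq.coeff_mul_weight_le (Finsupp.mem_support_iff.2 (hq.linear_ne_zero j)) α)
    exact lt_of_le_of_ne (hq.nonneg _) (hq.linear_ne_zero j).symm

/-- The words of length `p`. -/
def wordsOfLength (N p : ℕ) : Finset (Word N) :=
  (List.finite_length_eq (Fin N) p).toFinset

theorem mem_wordsOfLength {p : ℕ} {α : Word N} : α ∈ wordsOfLength N p ↔ α.length = p :=
  Set.Finite.mem_toFinset _

theorem multidegree_eq_piFinset {k : ℕ} (n : Fin k → ℕ) (p : Fin k → ℕ) :
    multidegree n p = Fintype.piFinset fun i => wordsOfLength (n i) (p i) := by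
  ext α
  rw [multidegree, Set.Finite.mem_toFinset, Fintype.mem_piFinset]
  exact forall_congr' fun i => mem_wordsOfLength.symm

end Weights

/-! ### Row contractions from the defect inequalities -/

section RowBounds

variable {H : Type*} [NormedAddCommGroup H] [InnerProductSpace ℂ H] [CompleteSpace H]

open ContinuousLinearMap

omit [CompleteSpace H] in
theorem evalWord_mul {N : ℕ} (X : Fin N → (H →L[ℂ] H)) (α β : Word N) :
    evalWord X (α * β) = evalWord X α * evalWord X β :=
  map_mul _ _ _

theorem sum_tailWeight_mul {N : ℕ} (q : NCPoly N) (β : Word N) (p : ℕ) (f : Word N → ℝ) :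
    ∑ ω ∈ wordsOfLength N (β.length + p), tailWeight q β ω * f ω =
      ∑ α ∈ wordsOfLength N p, weight q α * f (β * α) := by
  classical
  symm
  refine Finset.sum_of_injOn (fun α => β * α) (mul_right_injective β).injOn ?_ ?_ ?_
  · intro α hα
    have := mem_wordsOfLength.1 (Finset.mem_coe.1 hα)
    refine Finset.mem_coe.2 (mem_wordsOfLength.2 ?_)
    rw [FreeMonoid.length_mul, this]
  · intro ω hω h
    rw [tailWeight_of_forall_ne, zero_mul]
    rintro α rfl
    refine h ⟨α, Finset.mem_coe.2 (mem_wordsOfLength.2 ?_), rfl⟩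
    have := mem_wordsOfLength.1 hω
    rw [FreeMonoid.length_mul] at this
    omega
  · intro α _
    rw [tailWeight_mul]

/-- If `Φ_{q,X}(I) ≤ I`, then `∑_{|α| = p} b_α X_α X_α^* ≤ I`. -/
theorem sum_weight_mul_norm_adjoint_sq_le {N : ℕ} {q : NCPoly N} (hq : IsPositiveRegular q)
    (X : Fin N → (H →L[ℂ] H))
    (hX : ∀ y, ∑ β ∈ q.coeff.support, q.coeff β * ‖adjoint (evalWord X β) y‖ ^ 2 ≤ ‖y‖ ^ 2)
    (p : ℕ) (y : H) :
    ∑ α ∈ wordsOfLength N p, weight q α * ‖adjoint (evalWord X α) y‖ ^ 2 ≤ ‖y‖ ^ 2 := by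
  induction p using Nat.strong_induction_on generalizing y with
  | _ p ih =>
    rcases Nat.eq_zero_or_pos p with rfl | hp
    · have : wordsOfLength N 0 = {1} := by
        ext α
        rw [mem_wordsOfLength, Finset.mem_singleton]
        exact FreeMonoid.length_eq_zero
      rw [this, Finset.sum_singleton, weight_one, evalWord, map_one, one_mul]
      rw [← star_eq_adjoint, star_one]
      exact le_rfl
    · calc ∑ ω ∈ wordsOfLength N p, weight q ω * ‖adjoint (evalWord X ω) y‖ ^ 2
          = ∑ ω ∈ wordsOfLength N p, ∑ β ∈ q.coeff.support,
              q.coeff β * (tailWeight q β ω * ‖adjoint (evalWord X ω) y‖ ^ 2) := by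
            refine Finset.sum_congr rfl fun ω hω => ?_
            rw [hq.weight_eq_sum, Finset.sum_mul]
            · simp_rw [mul_assoc]
            · rintro rfl
              rw [mem_wordsOfLength, FreeMonoid.length_one] at hω
              omega
        _ = ∑ β ∈ q.coeff.support, q.coeff β *
              ∑ ω ∈ wordsOfLength N p, tailWeight q β ω * ‖adjoint (evalWord X ω) y‖ ^ 2 := by
            rw [Finset.sum_comm]
            simp_rw [Finset.mul_sum]
        -- For each β, apply the induction hypothesis to the vector X_β^* y in degree p - |β| < p; a
        -- β longer than p is a prefix of no word in the sum.
        _ ≤ ∑ β ∈ q.coeff.support, q.coeff β * ‖adjoint (evalWord X β) y‖ ^ 2 := by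
            refine Finset.sum_le_sum fun β hβ => mul_le_mul_of_nonneg_left ?_ (hq.nonneg β)
            have hβ0 := length_pos_of_ne_one (hq.ne_one hβ)
            by_cases hle : β.length ≤ p
            · obtain ⟨r, rfl⟩ := Nat.exists_eq_add_of_le hle
              rw [sum_tailWeight_mul]
              refine le_trans (le_of_eq ?_) (ih r (by omega) (adjoint (evalWord X β) y))
              refine Finset.sum_congr rfl fun α _ => ?_
              rw [evalWord_mul, ← star_eq_adjoint, star_mul]
              rfl
            · refine (Finset.sum_eq_zero fun ω hω => ?_).trans_le (sq_nonneg _)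
              rw [tailWeight_of_forall_ne, zero_mul]
              rintro α rfl
              rw [mem_wordsOfLength, FreeMonoid.length_mul] at hω
              omega
        _ ≤ ‖y‖ ^ 2 := hX y

/-- Peel off the first factor: the adjoint of the product sends y first to T_0^* y, where the bound
for the remaining factors applies. No commutation is needed. -/
theorem sum_piFinset_norm_adjoint_prod_sq_le {k : ℕ} {ι : Fin k → Type*}
    (S : ∀ i, Finset (ι i)) (c : ∀ i, ι i → ℝ) (T : ∀ i, ι i → (H →L[ℂ] H))
    (hc : ∀ i a, 0 ≤ c i a)
    (h : ∀ i y, ∑ a ∈ S i, c i a * ‖adjoint (T i a) y‖ ^ 2 ≤ ‖y‖ ^ 2) (y : H) :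
    ∑ a ∈ Fintype.piFinset S,
      (∏ i, c i (a i)) * ‖adjoint (List.ofFn fun i => T i (a i)).prod y‖ ^ 2 ≤ ‖y‖ ^ 2 := by
  induction k generalizing y with
  | zero =>
    simp only [Fintype.piFinset_of_isEmpty, Finset.univ_unique, Finset.sum_singleton,
      Finset.univ_eq_empty, Finset.prod_empty, List.ofFn_zero, List.prod_nil, one_mul]
    rw [← star_eq_adjoint, star_one]
    exact le_rfl
  | succ k ih =>
    calc _ = ∑ x ∈ S 0 ×ˢ Fintype.piFinset (fun i : Fin k => S i.succ),
          c 0 x.1 * ((∏ i : Fin k, c i.succ (x.2 i)) *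
            ‖adjoint (List.ofFn fun i : Fin k => T i.succ (x.2 i)).prod
              (adjoint (T 0 x.1) y)‖ ^ 2) := by
          refine Finset.sum_nbij' (fun a => (a 0, fun i => a i.succ))
            (fun x => Fin.cons x.1 x.2) ?_ ?_ ?_ ?_ ?_
          · intro a ha
            rw [Fintype.mem_piFinset] at ha
            exact Finset.mem_product.2 ⟨ha 0, Fintype.mem_piFinset.2 fun i => ha i.succ⟩
          · intro x hx
            rw [Finset.mem_product, Fintype.mem_piFinset] at hx
            exact Fintype.mem_piFinset.2 (Fin.cases hx.1 hx.2)
          · intro a _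
            exact Fin.cons_self_tail a
          · intro x _
            rfl
          · intro a _
            rw [Fin.prod_univ_succ, mul_assoc, List.ofFn_succ, List.prod_cons,
              ← star_eq_adjoint, star_mul]
            rfl
      _ = ∑ a ∈ S 0, c 0 a * ∑ b ∈ Fintype.piFinset (fun i : Fin k => S i.succ),
            (∏ i : Fin k, c i.succ (b i)) *
            ‖adjoint (List.ofFn fun i : Fin k => T i.succ (b i)).prod
              (adjoint (T 0 a) y)‖ ^ 2 := by
          rw [Finset.sum_product]
          simp_rw [Finset.mul_sum]
      _ ≤ ∑ a ∈ S 0, c 0 a * ‖adjoint (T 0 a) y‖ ^ 2 :=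
          Finset.sum_le_sum fun a _ => mul_le_mul_of_nonneg_left
            (ih _ _ _ (fun i => hc i.succ) (fun i => h i.succ) _) (hc 0 a)
      _ ≤ ‖y‖ ^ 2 := h 0 y

theorem Phi_apply {N : ℕ} (q : NCPoly N) (X : Fin N → (H →L[ℂ] H)) (T : H →L[ℂ] H) :
    Phi q X T = ∑ α ∈ q.coeff.support,
      (q.coeff α : ℂ) • (evalWord X α * T * adjoint (evalWord X α)) := by
  rw [Phi, Finsupp.sum, LinearMap.sum_apply]
  rfl

theorem defect_single {k : ℕ} {n : Fin k → ℕ} (q : ∀ i, NCPoly (n i)) (X : OpTuple n H)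
    (i : Fin k) : defect q X (Pi.single i 1) = 1 - Phi (q i) (X i) := by
  rw [defect, List.ofFn_eq_map, List.prod_map_eq_pow_single i]
  · rw [List.count_eq_one_of_mem (List.nodup_finRange k) (List.mem_finRange i)]
    simp
  · intro j hj _
    rw [Pi.single_eq_of_ne hj, pow_zero]

theorem sum_coeff_mul_norm_adjoint_sq_le {k : ℕ} {n : Fin k → ℕ} {q : ∀ i, NCPoly (n i)}
    {X : OpTuple n H} (hX : X ∈ closedPolydomain q H) (i : Fin k) (y : H) :
    ∑ β ∈ (q i).coeff.support, (q i).coeff β * ‖adjoint (evalWord (X i) β) y‖ ^ 2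
      ≤ ‖y‖ ^ 2 := by
  have h := (hX.2 (Pi.single i 1) fun j => by
    rw [Pi.single_apply]; split_ifs <;> norm_num).re_inner_nonneg_left y
  rw [defect_single, LinearMap.sub_apply, Phi_apply, sub_apply,
    inner_sub_left, map_sub, Module.End.one_apply, one_apply_eq_self,
    inner_self_eq_norm_sq, sum_apply, sum_inner, map_sum] at h
  refine le_trans (le_of_eq (Finset.sum_congr rfl fun β _ => ?_)) (sub_nonneg.1 h)
  rw [mul_one, smul_apply, inner_smul_left, Complex.conj_ofReal, mul_apply_eq_comp,
    ← adjoint_inner_right, ← inner_self_eq_norm_sq (𝕜 := ℂ)]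
  simp

theorem sum_multidegree_norm_adjoint_sq_le {k : ℕ} {n : Fin k → ℕ} {q : ∀ i, NCPoly (n i)}
    (hq : ∀ i, IsPositiveRegular (q i)) {X : OpTuple n H} (hX : X ∈ closedPolydomain q H)
    (p : Fin k → ℕ) (y : H) :
    ∑ α ∈ multidegree n p,
      (∏ i, weight (q i) (α i)) * ‖adjoint (evalMultiWord X α) y‖ ^ 2 ≤ ‖y‖ ^ 2 := by
  rw [multidegree_eq_piFinset]
  exact sum_piFinset_norm_adjoint_prod_sq_le _ (fun i => weight (q i)) (fun i => evalWord (X i))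
    (fun i => (hq i).weight_nonneg) (fun i y => sum_weight_mul_norm_adjoint_sq_le (hq i) _
      (sum_coeff_mul_norm_adjoint_sq_le hX i) (p i) y) y

end RowBounds

/-! ### Quadratic forms and a row-column Cauchy–Schwarz inequality -/

section Squares

variable {E : Type*} [NormedAddCommGroup E] [InnerProductSpace ℂ E] [CompleteSpace E]
variable {ι : Type*}

open ContinuousLinearMap

theorem inner_sum_smul_adjoint_mul (S : Finset ι) (w : ι → ℝ) (C : ι → (E →L[ℂ] E)) (x y : E) :
    inner ℂ x ((∑ a ∈ S, (w a : ℂ) • (adjoint (C a) * C a)) y) =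
      ∑ a ∈ S, (w a : ℂ) * inner ℂ (C a x) (C a y) := by
  rw [sum_apply, inner_sum]
  refine Finset.sum_congr rfl fun a _ => ?_
  rw [smul_apply, inner_smul_right, mul_apply_eq_comp, adjoint_inner_right]

theorem sum_mul_norm_sq_le (S : Finset ι) (w : ι → ℝ) (C : ι → (E →L[ℂ] E)) (x : E) :
    ∑ a ∈ S, w a * ‖C a x‖ ^ 2 ≤
      ‖∑ a ∈ S, (w a : ℂ) • (adjoint (C a) * C a)‖ * ‖x‖ ^ 2 := by
  set T := ∑ a ∈ S, (w a : ℂ) • (adjoint (C a) * C a) with hT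
  have h : ((∑ a ∈ S, w a * ‖C a x‖ ^ 2 : ℝ) : ℂ) = inner ℂ x (T x) := by
    rw [hT, inner_sum_smul_adjoint_mul]
    push_cast
    refine Finset.sum_congr rfl fun a _ => ?_
    rw [inner_self_eq_norm_sq_to_K]
    rfl
  calc ∑ a ∈ S, w a * ‖C a x‖ ^ 2 ≤ ‖((∑ a ∈ S, w a * ‖C a x‖ ^ 2 : ℝ) : ℂ)‖ := by
        rw [Complex.norm_real]; exact le_abs_self _
    _ = ‖inner ℂ x (T x)‖ := by rw [h]
    _ ≤ ‖x‖ * ‖T x‖ := norm_inner_le_norm _ _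
    _ ≤ ‖x‖ * (‖T‖ * ‖x‖) := by gcongr; exact T.le_opNorm x
    _ = ‖T‖ * ‖x‖ ^ 2 := by ring

theorem sum_mul_norm_mul_norm_le (S : Finset ι) {w : ι → ℝ} (hw : ∀ a, 0 ≤ w a)
    (f g : ι → ℝ) :
    ∑ a ∈ S, w a * (f a * g a) ≤
      √(∑ a ∈ S, w a * f a ^ 2) * √(∑ a ∈ S, w a * g a ^ 2) := by
  have h := Real.sum_mul_le_sqrt_mul_sqrt S (fun a => √(w a) * f a) (fun a => √(w a) * g a)
  have h1 : ∀ a, (√(w a) * f a) * (√(w a) * g a) = w a * (f a * g a) := fun a => by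
    rw [mul_mul_mul_comm, Real.mul_self_sqrt (hw a)]
  simpa only [h1, mul_pow, Real.sq_sqrt (hw _)] using h

/-- Converse to `sum_mul_norm_sq_le`: Cauchy–Schwarz passes from the quadratic form to the
sesquilinear form of the operator. -/
theorem norm_sum_smul_adjoint_mul_le (S : Finset ι) {w : ι → ℝ} (hw : ∀ a, 0 ≤ w a)
    (C : ι → (E →L[ℂ] E)) {M : ℝ} (hM : 0 ≤ M)
    (h : ∀ x, ∑ a ∈ S, w a * ‖C a x‖ ^ 2 ≤ M * ‖x‖ ^ 2) :
    ‖∑ a ∈ S, (w a : ℂ) • (adjoint (C a) * C a)‖ ≤ M := by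
  refine opNorm_le_bound _ hM fun y => ?_
  set T := ∑ a ∈ S, (w a : ℂ) • (adjoint (C a) * C a) with hT
  have key : ∀ x, ‖inner ℂ x (T y)‖ ≤ (M * ‖y‖) * ‖x‖ := fun x => by
    rw [hT, inner_sum_smul_adjoint_mul]
    calc ‖∑ a ∈ S, (w a : ℂ) * inner ℂ (C a x) (C a y)‖
        ≤ ∑ a ∈ S, w a * (‖C a x‖ * ‖C a y‖) := by
          refine (norm_sum_le _ _).trans (Finset.sum_le_sum fun a _ => ?_)
          rw [norm_mul, Complex.norm_real, Real.norm_of_nonneg (hw a)]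
          exact mul_le_mul_of_nonneg_left (norm_inner_le_norm _ _) (hw a)
      _ ≤ √(∑ a ∈ S, w a * ‖C a x‖ ^ 2) * √(∑ a ∈ S, w a * ‖C a y‖ ^ 2) :=
          sum_mul_norm_mul_norm_le S hw _ _
      _ ≤ √(M * ‖x‖ ^ 2) * √(M * ‖y‖ ^ 2) := by gcongr <;> exact h _
      _ = (M * ‖y‖) * ‖x‖ := by
          rw [← Real.sqrt_mul (by positivity),
            show M * ‖x‖ ^ 2 * (M * ‖y‖ ^ 2) = (M * ‖y‖ * ‖x‖) ^ 2 by ring,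
            Real.sqrt_sq (by positivity)]
  -- Test `key` with x = T y and cancel one factor ‖T y‖.
  rcases eq_or_ne (T y) 0 with h0 | h0
  · rw [h0, norm_zero]; positivity
  · have := key (T y)
    rw [inner_self_eq_norm_sq_to_K] at this
    simp only [norm_pow, RCLike.norm_ofReal, abs_norm] at this
    rw [sq] at this
    exact le_of_mul_le_mul_right this (norm_pos_iff.2 h0)

theorem norm_sum_mul_le (S : Finset ι) {w : ι → ℝ} (hw : ∀ a, 0 < w a)
    (R C : ι → (E →L[ℂ] E)) :
    ‖∑ a ∈ S, R a * C a‖ ≤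
      √‖∑ a ∈ S, (w a : ℂ) • (R a * adjoint (R a))‖ *
      √‖∑ a ∈ S, (((w a)⁻¹ : ℝ) : ℂ) • (adjoint (C a) * C a)‖ := by
  set P := ‖∑ a ∈ S, (w a : ℂ) • (R a * adjoint (R a))‖ with hP
  set Q := ‖∑ a ∈ S, (((w a)⁻¹ : ℝ) : ℂ) • (adjoint (C a) * C a)‖ with hQ
  have hR : ∀ x, ∑ a ∈ S, w a * ‖adjoint (R a) x‖ ^ 2 ≤ P * ‖x‖ ^ 2 := fun x => by
    have := sum_mul_norm_sq_le S w (fun a => adjoint (R a)) x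
    simpa only [adjoint_adjoint] using this
  have hC : ∀ x, ∑ a ∈ S, (w a)⁻¹ * ‖C a x‖ ^ 2 ≤ Q * ‖x‖ ^ 2 := sum_mul_norm_sq_le S _ C
  refine opNorm_le_bound _ (by positivity) fun y => ?_
  set z := (∑ a ∈ S, R a * C a) y with hz
  have key : ‖z‖ ^ 2 ≤ (√P * √Q * ‖y‖) * ‖z‖ := by
    have h1 : ((‖z‖ ^ 2 : ℝ) : ℂ) = ∑ a ∈ S, inner ℂ (adjoint (R a) z) (C a y) := by
      rw [Complex.ofReal_pow]
      refine (inner_self_eq_norm_sq_to_K (𝕜 := ℂ) z).symm.trans ?_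
      have h2 : ∀ x, inner ℂ x ((∑ a ∈ S, R a * C a) y) =
          ∑ a ∈ S, inner ℂ (adjoint (R a) x) (C a y) := fun x => by
        rw [sum_apply, inner_sum]
        refine Finset.sum_congr rfl fun a _ => ?_
        rw [adjoint_inner_left, mul_apply_eq_comp]
      exact h2 z
    calc ‖z‖ ^ 2 = ‖((‖z‖ ^ 2 : ℝ) : ℂ)‖ := by
          rw [Complex.norm_real, Real.norm_of_nonneg (sq_nonneg _)]
      -- Inserting w · w⁻¹ makes Cauchy–Schwarz with weight w leave w · (w⁻¹)² = w⁻¹ on the column.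
      _ ≤ ∑ a ∈ S, w a * (‖adjoint (R a) z‖ * ((w a)⁻¹ * ‖C a y‖)) := by
          rw [h1]
          refine (norm_sum_le _ _).trans (Finset.sum_le_sum fun a _ => ?_)
          refine (norm_inner_le_norm _ _).trans (le_of_eq ?_)
          have := (hw a).ne'
          field_simp
      _ ≤ √(∑ a ∈ S, w a * ‖adjoint (R a) z‖ ^ 2) *
            √(∑ a ∈ S, w a * ((w a)⁻¹ * ‖C a y‖) ^ 2) :=
          sum_mul_norm_mul_norm_le S (fun a => (hw a).le) _ _
      _ ≤ √(P * ‖z‖ ^ 2) * √(Q * ‖y‖ ^ 2) := by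
          gcongr
          · exact hR z
          · refine le_trans (le_of_eq (Finset.sum_congr rfl fun a _ => ?_)) (hC y)
            have := (hw a).ne'
            field_simp
      _ = (√P * √Q * ‖y‖) * ‖z‖ := by
          rw [Real.sqrt_mul (by positivity), Real.sqrt_mul (by positivity),
            Real.sqrt_sq (by positivity), Real.sqrt_sq (by positivity)]
          ring
  rcases (norm_nonneg z).eq_or_lt with h0 | h0
  · rw [← h0]; positivity
  · rw [sq] at key
    exact le_of_mul_le_mul_right key h0

end Squares

/-! ### Operators on the Hilbert space tensor product -/

section Tensor

variable {K : Type*} [NormedAddCommGroup K] [InnerProductSpace ℂ K]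
variable {H : Type*} [NormedAddCommGroup H] [InnerProductSpace ℂ H]

open ContinuousLinearMap

theorem opTensor_coe (A : K →L[ℂ] K) (X : H →L[ℂ] H) (v : K ⊗[ℂ] H) :
    opTensor A X (v : HilbertTensor K H) =
      ((TensorProduct.mapL A X v : K ⊗[ℂ] H) : HilbertTensor K H) :=
  ContinuousLinearMap.completion_apply_coe _ _

theorem hilbertTensor_op_ext {S T : HilbertTensor K H →L[ℂ] HilbertTensor K H}
    (h : ∀ v : K ⊗[ℂ] H, S v = T v) : S = T := by
  refine ContinuousLinearMap.ext fun x => ?_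
  induction x using UniformSpace.Completion.induction_on with
  | hp => exact isClosed_eq S.continuous T.continuous
  | ih v => exact h v

theorem opTensor_mul (A B : K →L[ℂ] K) (X Y : H →L[ℂ] H) :
    opTensor (A * B) (X * Y) = opTensor A X * opTensor B Y :=
  hilbertTensor_op_ext fun v => by
    rw [mul_apply_eq_comp, opTensor_coe, opTensor_coe, opTensor_coe, TensorProduct.mapL_mul,
      mul_apply_eq_comp]

theorem opTensor_sum_smul_left {ι : Type*} (S : Finset ι) (c : ι → ℂ) (A : ι → (K →L[ℂ] K))
    (X : H →L[ℂ] H) :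
    opTensor (∑ a ∈ S, c a • A a) X = ∑ a ∈ S, c a • opTensor (A a) X :=
  hilbertTensor_op_ext fun v => by
    rw [sum_apply]
    simp_rw [smul_apply, opTensor_coe]
    have : TensorProduct.mapL (∑ a ∈ S, c a • A a) X v =
        ∑ a ∈ S, c a • TensorProduct.mapL (A a) X v := by
      induction v using TensorProduct.induction_on with
      | zero => simp
      | tmul x y => simp [TensorProduct.sum_tmul, TensorProduct.smul_tmul']
      | add u v hu hv => simp only [map_add, hu, hv, smul_add, Finset.sum_add_distrib]
    rw [this]
    simpa only [map_smul, UniformSpace.Completion.coe_toComplL] using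
      map_sum (UniformSpace.Completion.toComplL (𝕜 := ℂ) (E := K ⊗[ℂ] H)) (fun a => c a • TensorProduct.mapL (A a) X v) S

theorem opTensor_sum_smul_right {ι : Type*} (S : Finset ι) (c : ι → ℂ) (A : K →L[ℂ] K)
    (X : ι → (H →L[ℂ] H)) :
    opTensor A (∑ a ∈ S, c a • X a) = ∑ a ∈ S, c a • opTensor A (X a) :=
  hilbertTensor_op_ext fun v => by
    rw [sum_apply]
    simp_rw [smul_apply, opTensor_coe]
    have : TensorProduct.mapL A (∑ a ∈ S, c a • X a) v =
        ∑ a ∈ S, c a • TensorProduct.mapL A (X a) v := by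
      induction v using TensorProduct.induction_on with
      | zero => simp
      | tmul x y => simp [TensorProduct.tmul_sum]
      | add u v hu hv => simp only [map_add, hu, hv, smul_add, Finset.sum_add_distrib]
    rw [this]
    simpa only [map_smul, UniformSpace.Completion.coe_toComplL] using
      map_sum (UniformSpace.Completion.toComplL (𝕜 := ℂ) (E := K ⊗[ℂ] H)) (fun a => c a • TensorProduct.mapL A (X a) v) S

theorem opTensor_smul_right (c : ℂ) (A : K →L[ℂ] K) (X : H →L[ℂ] H) :
    opTensor A (c • X) = c • opTensor A X := by
  simpa using opTensor_sum_smul_right {()} (fun _ => c) A (fun _ => X)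

theorem norm_opTensor_le (A : K →L[ℂ] K) (X : H →L[ℂ] H) : ‖opTensor A X‖ ≤ ‖A‖ * ‖X‖ := by
  refine opNorm_le_bound _ (by positivity) fun x => ?_
  induction x using UniformSpace.Completion.induction_on with
  | hp => exact isClosed_le (by fun_prop) (by fun_prop)
  | ih v =>
    rw [opTensor_coe, UniformSpace.Completion.norm_coe, UniformSpace.Completion.norm_coe]
    exact le_of_opNorm_le _ (TensorProduct.norm_mapL_le A X) v

theorem adjoint_opTensor [CompleteSpace K] [CompleteSpace H] (A : K →L[ℂ] K) (X : H →L[ℂ] H) :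
    adjoint (opTensor A X) = opTensor (adjoint A) (adjoint X) := by
  symm
  rw [eq_adjoint_iff]
  intro x y
  induction x, y using UniformSpace.Completion.induction_on₂ with
  | hp => exact isClosed_eq (by fun_prop) (by fun_prop)
  | ih u v =>
    rw [opTensor_coe, opTensor_coe, UniformSpace.Completion.inner_coe,
      UniformSpace.Completion.inner_coe]
    induction u using TensorProduct.induction_on with
    | zero => simp
    | add u u' hu hu' => simp only [map_add, inner_add_left, hu, hu']
    | tmul a b =>
      induction v using TensorProduct.induction_on with
      | zero => simp
      | add u u' hu hu' => simp only [map_add, inner_add_right, hu, hu']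
      | tmul c d => simp [adjoint_inner_left]

/-- In A ⊗ X = (1 ⊗ X)(A ⊗ 1) the hypothesis makes the weighted row of the 1 ⊗ X a contraction, so
only the column of the A ⊗ 1 remains. -/
theorem norm_sum_opTensor_le [CompleteSpace K] [CompleteSpace H] {ι : Type*} (S : Finset ι)
    {w : ι → ℝ} (hw : ∀ a, 0 < w a) (A : ι → (K →L[ℂ] K)) (X : ι → (H →L[ℂ] H))
    (hX : ∀ y, ∑ a ∈ S, w a * ‖adjoint (X a) y‖ ^ 2 ≤ ‖y‖ ^ 2) :
    ‖∑ a ∈ S, opTensor (A a) (X a)‖ ≤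
      √‖∑ a ∈ S, (((w a)⁻¹ : ℝ) : ℂ) • (adjoint (A a) * A a)‖ := by
  have hsplit : ∀ a, opTensor (A a) (X a) = opTensor 1 (X a) * opTensor (A a) 1 := fun a => by
    rw [← opTensor_mul, one_mul, mul_one]
  have hR : ‖∑ a ∈ S, (w a : ℂ) • (opTensor (1 : K →L[ℂ] K) (X a) *
      adjoint (opTensor (1 : K →L[ℂ] K) (X a)))‖ ≤ 1 := by
    simp_rw [adjoint_opTensor, ← opTensor_mul, ← opTensor_sum_smul_right]
    refine (norm_opTensor_le _ _).trans (mul_le_one₀ ?_ (norm_nonneg _) ?_)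
    · rw [← star_eq_adjoint, star_one, one_mul]
      exact norm_id_le
    · have := norm_sum_smul_adjoint_mul_le S (fun a => (hw a).le) (fun a => adjoint (X a))
        zero_le_one (fun y => by rw [one_mul]; exact hX y)
      simpa only [adjoint_adjoint] using this
  have hC : ‖∑ a ∈ S, (((w a)⁻¹ : ℝ) : ℂ) • (adjoint (opTensor (A a) (1 : H →L[ℂ] H)) *
      opTensor (A a) (1 : H →L[ℂ] H))‖ ≤
      ‖∑ a ∈ S, (((w a)⁻¹ : ℝ) : ℂ) • (adjoint (A a) * A a)‖ := by
    simp_rw [adjoint_opTensor, ← opTensor_mul, ← opTensor_sum_smul_left]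
    refine (norm_opTensor_le _ _).trans (mul_le_of_le_one_right (norm_nonneg _) ?_)
    rw [← star_eq_adjoint, star_one, one_mul]
    exact norm_id_le
  simp_rw [hsplit]
  refine (norm_sum_mul_le S hw _ _).trans ?_
  calc _ ≤ √1 * √‖∑ a ∈ S, (((w a)⁻¹ : ℝ) : ℂ) • (adjoint (A a) * A a)‖ := by gcongr
    _ = _ := by rw [Real.sqrt_one, one_mul]

end Tensor

/-! ### Homogeneity, the root test and uniform convergence -/

section Convergence

variable {k : ℕ} {n : Fin k → ℕ} {q : ∀ i, NCPoly (n i)}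
variable {K : Type*} [NormedAddCommGroup K] [InnerProductSpace ℂ K]
variable {H : Type*} [NormedAddCommGroup H] [InnerProductSpace ℂ H]

theorem evalWord_smul {N : ℕ} (c : ℂ) (X : Fin N → (H →L[ℂ] H)) (α : Word N) :
    evalWord (c • X) α = c ^ α.length • evalWord X α := by
  induction α using FreeMonoid.recOn with
  | one => simp [evalWord]
  | of_mul j α h =>
    rw [evalWord_mul, evalWord_mul, h, FreeMonoid.length_mul, FreeMonoid.length_of, pow_add,
      pow_one, mul_smul, mul_smul_comm]
    simp [evalWord, smul_comm c]

theorem evalMultiWord_smul (c : ℂ) (X : OpTuple n H) (α : MultiWord n) :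
    evalMultiWord (c • X) α = c ^ (∑ i, (α i).length) • evalMultiWord X α := by
  have : ∀ l : List (Fin k), (l.map fun i => evalWord ((c • X) i) (α i)).prod =
      c ^ (l.map fun i => (α i).length).sum • (l.map fun i => evalWord (X i) (α i)).prod := by
    intro l
    induction l with
    | nil => simp
    | cons i l ih =>
      simp only [List.map_cons, List.prod_cons, List.sum_cons, ih]
      rw [Pi.smul_apply, evalWord_smul, pow_add, mul_smul_comm, smul_mul_assoc, smul_smul,
        mul_comm]
  rw [evalMultiWord, evalMultiWord, List.ofFn_eq_map, List.ofFn_eq_map, this,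
    ← List.ofFn_eq_map, List.sum_ofFn]

theorem mem_totalDegree {m : ℕ} {α : MultiWord n} :
    α ∈ totalDegree n m ↔ ∑ i, (α i).length = m :=
  Set.Finite.mem_toFinset _

theorem mem_multidegree {p : Fin k → ℕ} {α : MultiWord n} :
    α ∈ multidegree n p ↔ ∀ i, (α i).length = p i :=
  Set.Finite.mem_toFinset _

theorem homogeneousPart_smul (A : MultiWord n → (K →L[ℂ] K)) (m : ℕ) (c : ℂ)
    (X : OpTuple n H) : homogeneousPart A m (c • X) = c ^ m • homogeneousPart A m X := by
  rw [homogeneousPart, homogeneousPart, Finset.smul_sum]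
  refine Finset.sum_congr rfl fun α hα => ?_
  rw [evalMultiWord_smul, opTensor_smul_right, mem_totalDegree.1 hα]

theorem homogeneousPart_eq_sum (A : MultiWord n → (K →L[ℂ] K)) (m : ℕ) (X : OpTuple n H) :
    homogeneousPart A m X = ∑ p ∈ Finset.piAntidiag Finset.univ m,
      ∑ α ∈ multidegree n p, opTensor (A α) (evalMultiWord X α) := by
  classical
  rw [homogeneousPart, ← Finset.sum_fiberwise_of_maps_to
    (g := fun (α : MultiWord n) i => (α i).length) (t := Finset.piAntidiag Finset.univ m)]
  · refine Finset.sum_congr rfl fun p hp => Finset.sum_congr ?_ fun _ _ => rfl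
    ext α
    rw [Finset.mem_filter, mem_multidegree, mem_totalDegree, funext_iff]
    refine ⟨fun h => h.2, fun h => ⟨?_, h⟩⟩
    rw [Finset.sum_congr rfl fun i _ => h i]
    exact (Finset.mem_piAntidiag.1 hp).1
  · intro α hα
    exact Finset.mem_piAntidiag.2 ⟨mem_totalDegree.1 hα, fun i _ => Finset.mem_univ i⟩

variable [CompleteSpace K] [CompleteSpace H]

theorem norm_homogeneousPart_le (hq : ∀ i, IsPositiveRegular (q i))
    (A : MultiWord n → (K →L[ℂ] K)) (m : ℕ) {X : OpTuple n H} (hX : X ∈ closedPolydomain q H) :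
    ‖homogeneousPart A m X‖ ≤
      ∑ p ∈ Finset.piAntidiag Finset.univ m, √‖weightedSquare q A p‖ := by
  rw [homogeneousPart_eq_sum]
  refine (norm_sum_le (E := HilbertTensor K H →L[ℂ] HilbertTensor K H) _ _).trans
    (Finset.sum_le_sum fun p _ => ?_)
  exact norm_sum_opTensor_le _ (fun α => Finset.prod_pos fun i _ => (hq i).weight_pos (α i)) A _
    (sum_multidegree_norm_adjoint_sq_le hq hX p)

theorem summable_pow_sum {t : ℝ} (h0 : 0 ≤ t) (h1 : t < 1) (k : ℕ) :
    Summable fun p : Fin k → ℕ => t ^ (∑ i, p i) := by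
  induction k with
  | zero => exact Summable.of_finite
  | succ k ih =>
    have h := (summable_geometric_of_lt_one h0 h1).mul_of_nonneg ih
      (fun _ => pow_nonneg h0 _) (fun _ => pow_nonneg h0 _)
    rw [← (Fin.consEquiv fun _ => ℕ).summable_iff]
    refine h.congr fun x => ?_
    simp [Fin.consEquiv, Fin.sum_univ_succ, pow_add]

/-- Root test: for r < ρ < γ, all but finitely many terms are at most (r/ρ)^{|p|}, and these sum to
a product of geometric series. -/
theorem summable_pow_mul_sqrt_weightedSquare (q : ∀ i, NCPoly (n i))
    (A : MultiWord n → (K →L[ℂ] K)) (r : ℝ≥0) (hr : (r : ℝ≥0∞) < radius q A) :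
    Summable fun p : Fin k → ℕ => (r : ℝ) ^ (∑ i, p i) * √‖weightedSquare q A p‖ := by
  obtain ⟨ρ, hrρ, hρ⟩ := ENNReal.lt_iff_exists_nnreal_btwn.1 hr
  have hrρ' : r < ρ := by exact_mod_cast hrρ
  have hρ0 : 0 < ρ := (zero_le).trans_lt hrρ'
  have hL := ENNReal.lt_inv_iff_lt_inv.1 hρ
  have hev := eventually_lt_of_limsup_lt hL
  -- At p = 0 the exponent 1/(2·0) is 0 by convention and the root carries no information; this
  -- index is discarded.
  have hne : ∀ᶠ p : Fin k → ℕ in cofinite, p ≠ 0 := (Set.finite_singleton 0).compl_mem_cofinite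
  have ht : (r : ℝ) / ρ < 1 := (div_lt_one (by exact_mod_cast hρ0)).2 (by exact_mod_cast hrρ')
  refine Summable.of_norm_bounded_eventually (summable_pow_sum (by positivity) ht k) ?_
  filter_upwards [hev, hne] with p hp hp0
  rw [Real.norm_of_nonneg (by positivity), div_pow, div_eq_mul_inv]
  refine mul_le_mul_of_nonneg_left ?_ (by positivity)
  set s := ∑ i, p i with hs
  have hs0 : s ≠ 0 := fun h => hp0 (funext fun i =>
    (Finset.sum_eq_zero_iff.1 (hs.symm.trans h)) i (Finset.mem_univ i))
  have h1 : ‖weightedSquare q A p‖ ^ (1 / (2 * (s : ℝ))) ≤ (ρ : ℝ)⁻¹ := by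
    rw [← ENNReal.coe_inv hρ0.ne', ← ENNReal.ofReal_coe_nnreal] at hp
    exact_mod_cast ((ENNReal.ofReal_lt_ofReal_iff (by positivity)).1 hp).le
  calc √‖weightedSquare q A p‖ = (‖weightedSquare q A p‖ ^ (1 / (2 * (s : ℝ)))) ^ s := by
        rw [← Real.rpow_natCast, ← Real.rpow_mul (norm_nonneg _), Real.sqrt_eq_rpow]
        congr 1
        have : (s : ℝ) ≠ 0 := by exact_mod_cast hs0
        field_simp
    _ ≤ ((ρ : ℝ)⁻¹) ^ s := by gcongr
    _ = ((ρ : ℝ) ^ s)⁻¹ := inv_pow _ _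

theorem summable_sum_piAntidiag {g : (Fin k → ℕ) → ℝ} (hg : Summable g) (h0 : ∀ p, 0 ≤ g p) :
    Summable fun m => ∑ p ∈ Finset.piAntidiag Finset.univ m, g p := by
  classical
  refine summable_of_sum_range_le (c := ∑' p, g p) (fun m => Finset.sum_nonneg fun p _ => h0 p)
    fun N => ?_
  rw [← Finset.sum_biUnion]
  · exact hg.sum_le_tsum _ fun p _ => h0 p
  · intro a _ b _ hab
    refine Finset.disjoint_left.2 fun p ha hb => hab ?_
    rw [← (Finset.mem_piAntidiag.1 ha).1, ← (Finset.mem_piAntidiag.1 hb).1]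

theorem tendstoUniformlyOn_sum_norm_homogeneousPart (hq : ∀ i, IsPositiveRegular (q i))
    (A : MultiWord n → (K →L[ℂ] K)) (r : ℝ≥0) (hr : (r : ℝ≥0∞) < radius q A) :
    TendstoUniformlyOn
      (fun (N : ℕ) (X : OpTuple n H) => ∑ m ∈ Finset.range N, ‖homogeneousPart A m X‖)
      (fun X => ∑' m, ‖homogeneousPart A m X‖) atTop
      (((r : ℝ) : ℂ) • closedPolydomain q H) := by
  refine tendstoUniformlyOn_tsum_nat (summable_sum_piAntidiag
    (summable_pow_mul_sqrt_weightedSquare q A r hr) fun p => by positivity) fun m X hX => ?_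
  obtain ⟨Z, hZ, rfl⟩ := Set.mem_smul_set.1 hX
  refine (norm_norm (E := HilbertTensor K H →L[ℂ] HilbertTensor K H) _).trans_le ?_
  rw [homogeneousPart_smul]
  refine (ContinuousLinearMap.opNorm_smul_le _ _).trans ?_
  rw [norm_pow, Complex.norm_real, NNReal.norm_eq]
  refine (mul_le_mul_of_nonneg_left (norm_homogeneousPart_le hq A m hZ)
    (by positivity)).trans (le_of_eq ?_)
  rw [Finset.mul_sum]
  refine Finset.sum_congr rfl fun p hp => ?_
  rw [(Finset.mem_piAntidiag.1 hp).1]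

end Convergence

/-! ### Weighted composition operators on ℓ² -/

section WeightedComposition

variable {ι : Type}

/-- The Hilbert space `ℓ²(ι)`. -/
abbrev EllTwo (ι : Type) : Type := lp (fun _ : ι => ℂ) 2

open ContinuousLinearMap

theorem exists_weightedComposition {σ : ι → ι} (hσ : Function.Injective σ) (c : ι → ℝ) {M : ℝ}
    (hc : ∀ i, |c i| ≤ M) :
    ∃ V : EllTwo ι →L[ℂ] EllTwo ι, ∀ f i, V f i = c i * f (σ i) := by
  have h2 : 0 < (2 : ℝ≥0∞).toReal := by norm_num
  -- Injectivity of σ turns the sum over `S` into a partial sum of ‖f‖². The bound uses |M| because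
  -- M may be negative when ι is empty.
  have key : ∀ (f : EllTwo ι) (S : Finset ι), ∑ i ∈ S, ‖(c i : ℂ) * f (σ i)‖ ^ (2 : ℝ≥0∞).toReal ≤
      (|M| * ‖f‖) ^ (2 : ℝ≥0∞).toReal := fun f S => by
    rw [Real.mul_rpow (abs_nonneg _) (norm_nonneg _)]
    refine le_trans ?_ (mul_le_mul_of_nonneg_left
      (lp.sum_rpow_le_norm_rpow h2 f (S.map ⟨σ, hσ⟩)) (by positivity))
    rw [Finset.sum_map, Finset.mul_sum]
    refine Finset.sum_le_sum fun i _ => ?_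
    rw [norm_mul, Real.mul_rpow (norm_nonneg _) (norm_nonneg _), Complex.norm_real]
    refine mul_le_mul_of_nonneg_right ?_ (by positivity)
    exact Real.rpow_le_rpow (norm_nonneg _) ((hc i).trans (le_abs_self M)) h2.le
  let V : EllTwo ι →ₗ[ℂ] EllTwo ι :=
    { toFun := fun f => ⟨fun i => (c i : ℂ) * f (σ i), memℓp_gen' (key f)⟩
      map_add' := fun f g => by
        ext i
        exact mul_add _ _ _
      map_smul' := fun a f => by
        ext i
        simp [mul_left_comm] }
  refine ⟨V.mkContinuous |M| fun f => ?_, fun f i => rfl⟩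
  exact lp.norm_le_of_forall_sum_le h2 (by positivity) (key f)

theorem inner_single_one_left [DecidableEq ι] (i : ι) (f : EllTwo ι) :
    inner ℂ (lp.single 2 i (1 : ℂ) : EllTwo ι) f = f i := by
  rw [lp.inner_single_left]
  simp

variable {σ : ι → ι} {c : ι → ℝ} {V : EllTwo ι →L[ℂ] EllTwo ι}

/-- Pair with the basis vector at σ i, which V sends to c_i e_i. -/
theorem adjoint_weightedComposition_apply (hσ : Function.Injective σ)
    (hV : ∀ f i, V f i = c i * f (σ i)) (g : EllTwo ι) (i : ι) :
    adjoint V g (σ i) = c i * g i := by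
  classical
  have h : V (lp.single 2 (σ i) (1 : ℂ)) = (c i : ℂ) • lp.single 2 i (1 : ℂ) := by
    ext j
    rw [hV, lp.coeFn_smul, Pi.smul_apply, lp.single_apply, lp.single_apply, smul_eq_mul]
    rcases eq_or_ne j i with rfl | hj
    · simp
    · rw [Pi.single_eq_of_ne hj, Pi.single_eq_of_ne (hσ.ne hj), mul_zero, mul_zero]
  rw [← inner_single_one_left, adjoint_inner_right, h, inner_smul_left, inner_single_one_left,
    Complex.conj_ofReal]

theorem adjoint_weightedComposition_apply_of_notMem (hV : ∀ f i, V f i = c i * f (σ i))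
    (g : EllTwo ι) {ω : ι} (hω : ∀ i, σ i ≠ ω) : adjoint V g ω = 0 := by
  classical
  have h : V (lp.single 2 ω (1 : ℂ)) = 0 := by
    ext j
    rw [hV, lp.single_apply, Pi.single_eq_of_ne (hω j), mul_zero]
    rfl
  rw [← inner_single_one_left, adjoint_inner_right, h, inner_zero_left]

/-- A diagonal operator with entries 0 and 1 is a projection, so T = T^* T. -/
theorem isPositive_of_apply_eq_ite {T : EllTwo ι →L[ℂ] EllTwo ι} {P : ι → Prop}
    [DecidablePred P] (hT : ∀ f i, T f i = if P i then f i else 0) : T.IsPositive := by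
  have hT' : ∀ f i, T f i = ((if P i then 1 else 0 : ℝ) : ℂ) * f (id i) := fun f i => by
    rw [hT]
    split_ifs <;> simp
  have h : T = adjoint T ∘L T := by
    refine ContinuousLinearMap.ext fun f => ?_
    ext i
    refine Eq.trans ?_ (adjoint_weightedComposition_apply Function.injective_id hT' (T f) i).symm
    rw [hT]
    split_ifs <;> simp
  rw [h]
  exact isPositive_adjoint_comp_self T

end WeightedComposition

/-! ### The universal model and divergence -/

section Model

variable {k : ℕ} {n : Fin k → ℕ} {q : ∀ i, NCPoly (n i)}

open ContinuousLinearMap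

/-- Left multiplication of the `i`-th word by `β`. -/
def leftMul (i : Fin k) (β : Word (n i)) (α : MultiWord n) : MultiWord n :=
  Function.update α i (β * α i)

theorem leftMul_same (i : Fin k) (β : Word (n i)) (α : MultiWord n) :
    leftMul i β α i = β * α i :=
  Function.update_self _ _ _

theorem leftMul_of_ne {i j : Fin k} (h : j ≠ i) (β : Word (n i)) (α : MultiWord n) :
    leftMul i β α j = α j :=
  Function.update_of_ne h _ _

theorem leftMul_injective (i : Fin k) (β : Word (n i)) :
    Function.Injective (leftMul (n := n) i β) := by
  intro α α' h
  ext1 j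
  have hj := congrFun h j
  rcases eq_or_ne j i with rfl | hne
  · rw [leftMul_same, leftMul_same] at hj
    exact mul_left_cancel hj
  · rwa [leftMul_of_ne hne, leftMul_of_ne hne] at hj

theorem leftMul_mul (i : Fin k) (β β' : Word (n i)) (α : MultiWord n) :
    leftMul i (β * β') α = leftMul i β (leftMul i β' α) := by
  simp [leftMul, mul_assoc]

theorem leftMul_comm {i j : Fin k} (h : i ≠ j) (β : Word (n i)) (β' : Word (n j))
    (α : MultiWord n) : leftMul i β (leftMul j β' α) = leftMul j β' (leftMul i β α) := by
  conv_lhs => rw [leftMul, leftMul_of_ne h, leftMul]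
  conv_rhs => rw [leftMul, leftMul_of_ne h.symm, leftMul]
  exact Function.update_comm h.symm _ _ _

/-- The coefficients of the weighted left creation operators. -/
def shiftWeight (q : ∀ i, NCPoly (n i)) (i : Fin k) (β : Word (n i)) (α : MultiWord n) : ℝ :=
  √(weight (q i) (α i) / weight (q i) (β * α i))

/-- The tuples of weighted left creation operators on `ℓ²(𝔽⁺_{n₁} × ⋯ × 𝔽⁺_{n_k})`, described
through their adjoints. -/
def IsWeightedCreation (q : ∀ i, NCPoly (n i)) (W : OpTuple n (EllTwo (MultiWord n))) : Prop :=
  ∀ i j f α, adjoint (W i j) f α =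
    shiftWeight q i (FreeMonoid.of j) α * f (leftMul i (FreeMonoid.of j) α)

theorem exists_isWeightedCreation (hq : ∀ i, IsPositiveRegular (q i)) :
    ∃ W : OpTuple n (EllTwo (MultiWord n)), IsWeightedCreation q W := by
  have h : ∀ i (j : Fin (n i)), ∃ V : EllTwo (MultiWord n) →L[ℂ] EllTwo (MultiWord n),
      ∀ f α, V f α =
        shiftWeight q i (FreeMonoid.of j) α * f (leftMul i (FreeMonoid.of j) α) := fun i j => by
    refine exists_weightedComposition (leftMul_injective i _) _
      -- The recursion gives a_g b_α ≤ b_{gα}, and a_g > 0 for a generator g.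
      (M := √(1 / (q i).coeff (FreeMonoid.of j))) fun α => ?_
    rw [shiftWeight, abs_of_nonneg (Real.sqrt_nonneg _)]
    refine Real.sqrt_le_sqrt ?_
    have hj : 0 < (q i).coeff (FreeMonoid.of j) :=
      lt_of_le_of_ne ((hq i).nonneg _) ((hq i).linear_ne_zero j).symm
    rw [div_le_div_iff₀ ((hq i).weight_pos _) hj, one_mul, mul_comm]
    exact (hq i).coeff_mul_weight_le (Finsupp.mem_support_iff.2 hj.ne') _
  choose V hV using h
  exact ⟨fun i j => adjoint (V i j), fun i j f α => by rw [adjoint_adjoint, hV]⟩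

theorem adjoint_one {E : Type*} [NormedAddCommGroup E] [InnerProductSpace ℂ E]
    [CompleteSpace E] : adjoint (1 : E →L[ℂ] E) = 1 := by
  rw [← star_eq_adjoint, star_one]

theorem adjoint_mul_apply {E : Type*} [NormedAddCommGroup E] [InnerProductSpace ℂ E]
    [CompleteSpace E] (S T : E →L[ℂ] E) (x : E) :
    adjoint (S * T) x = adjoint T (adjoint S x) := by
  rw [← star_eq_adjoint, star_mul]
  rfl

variable {W : OpTuple n (EllTwo (MultiWord n))}

/-- The ratios of weights telescope along the word. -/
theorem IsWeightedCreation.adjoint_evalWord_apply (hq : ∀ i, IsPositiveRegular (q i))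
    (hW : IsWeightedCreation q W) (i : Fin k) (β : Word (n i)) (f : EllTwo (MultiWord n))
    (α : MultiWord n) :
    adjoint (evalWord (W i) β) f α = shiftWeight q i β α * f (leftMul i β α) := by
  induction β using FreeMonoid.recOn generalizing f with
  | one =>
    have h : evalWord (W i) 1 = 1 := map_one _
    rw [h, adjoint_one, shiftWeight, one_mul, div_self ((hq i).weight_pos _).ne', Real.sqrt_one,
      leftMul, one_mul, Function.update_eq_self]
    simp
  | of_mul j β ih =>
    have hj : evalWord (W i) (FreeMonoid.of j) = W i j := FreeMonoid.lift_eval_of _ _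
    rw [evalWord_mul, adjoint_mul_apply, ih, hj, hW, leftMul_mul, ← mul_assoc,
      ← Complex.ofReal_mul, shiftWeight, shiftWeight, shiftWeight,
      ← Real.sqrt_mul (div_nonneg ((hq i).weight_nonneg _) ((hq i).weight_nonneg _)),
      leftMul_same, mul_assoc, div_mul_div_cancel₀ ((hq i).weight_pos _).ne']

theorem IsWeightedCreation.commute (hW : IsWeightedCreation q W) {s t : Fin k} (hst : s ≠ t)
    (i : Fin (n s)) (j : Fin (n t)) : Commute (W s i) (W t j) := by
  refine star_injective (ContinuousLinearMap.ext fun f => ?_)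
  rw [star_eq_adjoint, star_eq_adjoint, adjoint_mul_apply, adjoint_mul_apply]
  ext α
  rw [hW, hW, hW, hW, leftMul_comm hst, shiftWeight, shiftWeight, shiftWeight, shiftWeight,
    leftMul_of_ne hst, leftMul_of_ne hst.symm]
  ring

/-- W_β D W_β^* is again diagonal: it removes the prefix β and restores it, and `hd` makes the entry
of D the same before and after. -/
theorem IsWeightedCreation.evalWord_mul_diagonal_mul_adjoint_apply
    (hq : ∀ i, IsPositiveRegular (q i)) (hW : IsWeightedCreation q W) (i : Fin k)
    {D : EllTwo (MultiWord n) →L[ℂ] EllTwo (MultiWord n)} {d : MultiWord n → ℂ}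
    (hD : ∀ f ω, D f ω = d ω * f ω) (hd : ∀ β ω, d (leftMul i β ω) = d ω)
    (β : Word (n i)) (f : EllTwo (MultiWord n)) (ω : MultiWord n) :
    (evalWord (W i) β * D * adjoint (evalWord (W i) β)) f ω =
      ((tailWeight (q i) β (ω i) / weight (q i) (ω i) : ℝ) : ℂ) * (d ω * f ω) := by
  have hadj := hW.adjoint_evalWord_apply hq i β
  rw [mul_apply_eq_comp, mul_apply_eq_comp, ← adjoint_adjoint (evalWord (W i) β)]
  by_cases h : ∃ α, leftMul i β α = ω
  · obtain ⟨α, rfl⟩ := h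
    rw [adjoint_weightedComposition_apply (leftMul_injective i β) hadj, hD, adjoint_adjoint,
      hadj, leftMul_same, tailWeight_mul, hd,
      ← Real.mul_self_sqrt (div_nonneg ((hq i).weight_nonneg (α i))
        ((hq i).weight_nonneg (β * α i))), shiftWeight]
    push_cast
    ring
  · push Not at h
    rw [adjoint_weightedComposition_apply_of_notMem hadj _ h, tailWeight_of_forall_ne, zero_div,
      Complex.ofReal_zero, zero_mul]
    intro α hα
    refine h (Function.update ω i α) ?_
    rw [leftMul, Function.update_self, Function.update_idem, hα, Function.update_eq_self]

-- Summed over β with coefficients a_β, the tail weights give b_{ω_i} by the recursion when ω_i ≠ 1;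
-- an empty ω_i has no nonempty prefix, so nothing survives.
open Classical in
theorem IsWeightedCreation.Phi_diagonal_apply (hq : ∀ i, IsPositiveRegular (q i))
    (hW : IsWeightedCreation q W) (i : Fin k)
    {D : EllTwo (MultiWord n) →L[ℂ] EllTwo (MultiWord n)} {d : MultiWord n → ℂ}
    (hD : ∀ f ω, D f ω = d ω * f ω) (hd : ∀ β ω, d (leftMul i β ω) = d ω)
    (f : EllTwo (MultiWord n)) (ω : MultiWord n) :
    Phi (q i) (W i) D f ω = if ω i = 1 then 0 else d ω * f ω := by
  have hterm : Phi (q i) (W i) D f ω = ((∑ β ∈ (q i).coeff.support,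
      (q i).coeff β * tailWeight (q i) β (ω i) : ℝ) : ℂ) * ((weight (q i) (ω i))⁻¹ : ℝ) *
        (d ω * f ω) := by
    rw [Phi_apply, sum_apply, lp.coeFn_sum, Finset.sum_apply, Complex.ofReal_sum,
      Finset.sum_mul, Finset.sum_mul]
    refine Finset.sum_congr rfl fun β _ => ?_
    rw [smul_apply, lp.coeFn_smul, Pi.smul_apply,
      hW.evalWord_mul_diagonal_mul_adjoint_apply hq i hD hd, smul_eq_mul]
    push_cast
    ring
  rw [hterm]
  split_ifs with h
  · rw [Finset.sum_eq_zero, Complex.ofReal_zero, zero_mul, zero_mul]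
    intro β hβ
    rw [tailWeight_of_forall_ne, mul_zero]
    intro α hα
    have h1 := length_pos_of_ne_one ((hq i).ne_one hβ)
    have h2 := congrArg FreeMonoid.length (hα.trans h)
    rw [FreeMonoid.length_mul, FreeMonoid.length_one] at h2
    omega
  · rw [← (hq i).weight_eq_sum h, ← Complex.ofReal_mul,
      mul_inv_cancel₀ ((hq i).weight_pos _).ne', Complex.ofReal_one, one_mul]

open Classical in
theorem IsWeightedCreation.defect_apply (hq : ∀ i, IsPositiveRegular (q i))
    (hW : IsWeightedCreation q W) {p : Fin k → ℕ} (hp : ∀ i, p i ≤ 1)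
    (l : List (Fin k)) (hl : l.Nodup) (f : EllTwo (MultiWord n)) (ω : MultiWord n) :
    ((l.map fun i => (1 - Phi (q i) (W i)) ^ p i).prod 1 :
        EllTwo (MultiWord n) →L[ℂ] EllTwo (MultiWord n)) f ω =
      if ∀ i ∈ l, p i = 1 → ω i = 1 then f ω else 0 := by
  induction l generalizing f ω with
  | nil => simp
  | cons i l ih =>
    rw [List.nodup_cons] at hl
    rw [List.map_cons, List.prod_cons, Module.End.mul_apply]
    set D := (l.map fun i => (1 - Phi (q i) (W i)) ^ p i).prod 1
    simp only [List.forall_mem_cons]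
    rcases Nat.le_one_iff_eq_zero_or_eq_one.1 (hp i) with h0 | h1
    · rw [h0, pow_zero, Module.End.one_apply, ih hl.2]
      simp
    · have hD : ∀ f ω, D f ω = (if ∀ j ∈ l, p j = 1 → ω j = 1 then 1 else 0 : ℂ) * f ω :=
        fun f ω => by
          rw [ih hl.2]
          split_ifs <;> simp
      rw [h1, pow_one, LinearMap.sub_apply, Module.End.one_apply, sub_apply, lp.coeFn_sub,
        Pi.sub_apply, hW.Phi_diagonal_apply hq i hD, hD]
      · by_cases hi : ω i = 1 <;> simp [hi]
      -- Since i does not occur in `l`, the diagonal built so far ignores the i-th word.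
      · intro β ω
        refine if_congr (forall₂_congr fun j hj => ?_) rfl rfl
        rw [leftMul_of_ne (by rintro rfl; exact hl.1 hj)]

theorem IsWeightedCreation.mem_closedPolydomain (hq : ∀ i, IsPositiveRegular (q i))
    (hW : IsWeightedCreation q W) : W ∈ closedPolydomain q (EllTwo (MultiWord n)) := by
  classical
  refine ⟨fun s t hst i j => hW.commute hst i j, fun p hp => ?_⟩
  rw [defect, List.ofFn_eq_map]
  exact isPositive_of_apply_eq_ite (hW.defect_apply hq hp _ (List.nodup_finRange k))

/-- As `l` has no repetitions, each coordinate is still empty when its operator acts, so the shift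
weight is (b_1/b_α)^{1/2} = b_α^{-1/2}. -/
theorem IsWeightedCreation.adjoint_prod_apply_one (hq : ∀ i, IsPositiveRegular (q i))
    (hW : IsWeightedCreation q W) (α : MultiWord n) (l : List (Fin k)) (hl : l.Nodup)
    (f : EllTwo (MultiWord n)) :
    adjoint (l.map fun i => evalWord (W i) (α i)).prod f 1 =
      (((l.map fun i => (√(weight (q i) (α i)))⁻¹).prod : ℝ) : ℂ) *
        f (fun i => if i ∈ l then α i else 1) := by
  induction l generalizing f with
  | nil =>
    rw [List.map_nil, List.prod_nil, adjoint_one]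
    simp only [List.map_nil, List.prod_nil, Complex.ofReal_one, one_mul, List.not_mem_nil,
      if_false]
    rfl
  | cons i l ih =>
    rw [List.nodup_cons] at hl
    rw [List.map_cons, List.prod_cons, adjoint_mul_apply, ih hl.2,
      hW.adjoint_evalWord_apply hq, List.map_cons, List.prod_cons, shiftWeight, if_neg hl.1,
      mul_one, weight_one, one_div, Real.sqrt_inv, ← mul_assoc, ← Complex.ofReal_mul,
      mul_comm (List.prod _)]
    refine congrArg (fun γ => _ * f γ) (funext fun j => ?_)
    rcases eq_or_ne j i with rfl | hj
    · rw [leftMul_same, if_neg hl.1, mul_one, if_pos List.mem_cons_self]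
    · rw [leftMul_of_ne hj]
      simp [hj]

theorem IsWeightedCreation.evalMultiWord_single_one [DecidableEq (MultiWord n)]
    (hq : ∀ i, IsPositiveRegular (q i)) (hW : IsWeightedCreation q W) (α : MultiWord n) :
    evalMultiWord W α (lp.single 2 1 (1 : ℂ)) =
      ((√(∏ i, weight (q i) (α i))⁻¹ : ℝ) : ℂ) • lp.single 2 α (1 : ℂ) := by
  refine ext_inner_right ℂ fun f => ?_
  rw [← adjoint_inner_right, inner_single_one_left, inner_smul_left, inner_single_one_left,
    Complex.conj_ofReal, evalMultiWord, List.ofFn_eq_map,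
    hW.adjoint_prod_apply_one hq α _ (List.nodup_finRange k)]
  simp only [List.mem_finRange, if_true]
  rw [← List.ofFn_eq_map, List.prod_ofFn, ← Finset.prod_inv_distrib,
    Real.sqrt_prod _ fun i _ => inv_nonneg.2 ((hq i).weight_nonneg _)]
  simp_rw [Real.sqrt_inv]

variable {K : Type*} [NormedAddCommGroup K] [InnerProductSpace ℂ K]

theorem norm_sq_sum_tmul_single {ι : Type} [DecidableEq ι] (S : Finset ι) (u : ι → K) :
    ‖∑ a ∈ S, u a ⊗ₜ[ℂ] (lp.single 2 a (1 : ℂ) : EllTwo ι)‖ ^ 2 = ∑ a ∈ S, ‖u a‖ ^ 2 := by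
  rw [← inner_self_eq_norm_sq (𝕜 := ℂ), sum_inner, map_sum]
  refine Finset.sum_congr rfl fun a ha => ?_
  rw [inner_sum, Finset.sum_eq_single_of_mem a ha]
  · rw [TensorProduct.inner_tmul, inner_single_one_left, lp.single_apply_self, mul_one,
      inner_self_eq_norm_sq]
  · intro b _ hb
    rw [TensorProduct.inner_tmul, inner_single_one_left, lp.single_apply_ne _ _ _ hb.symm,
      mul_zero]

/-- Apply the homogeneous part to x ⊗ e_1: the vectors A_α x ⊗ W_α e_1 are pairwise orthogonal. -/
theorem IsWeightedCreation.sum_totalDegree_le (hq : ∀ i, IsPositiveRegular (q i))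
    (hW : IsWeightedCreation q W) (A : MultiWord n → (K →L[ℂ] K)) (m : ℕ) (x : K) :
    ∑ α ∈ totalDegree n m, (∏ i, weight (q i) (α i))⁻¹ * ‖A α x‖ ^ 2 ≤
      ‖homogeneousPart A m W‖ ^ 2 * ‖x‖ ^ 2 := by
  classical
  set e : EllTwo (MultiWord n) := lp.single 2 1 (1 : ℂ) with he
  have happ : homogeneousPart A m W (x ⊗ₜ[ℂ] e : K ⊗[ℂ] EllTwo (MultiWord n)) =
      ((∑ α ∈ totalDegree n m, (((√(∏ i, weight (q i) (α i))⁻¹ : ℝ) : ℂ) • A α x) ⊗ₜ[ℂ]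
        (lp.single 2 α (1 : ℂ) : EllTwo (MultiWord n)) : K ⊗[ℂ] EllTwo (MultiWord n)) :
          HilbertTensor K (EllTwo (MultiWord n))) := by
    rw [homogeneousPart, sum_apply]
    refine Eq.trans (Finset.sum_congr rfl fun α _ => ?_)
      (map_sum (UniformSpace.Completion.toComplL (𝕜 := ℂ)
        (E := K ⊗[ℂ] EllTwo (MultiWord n))) _ _).symm
    rw [opTensor_coe, TensorProduct.mapL_tmul, he, hW.evalMultiWord_single_one hq,
      TensorProduct.tmul_smul, TensorProduct.smul_tmul']
    rfl
  have hnorm : ‖(x ⊗ₜ[ℂ] e : K ⊗[ℂ] EllTwo (MultiWord n))‖ = ‖x‖ := by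
    rw [TensorProduct.norm_tmul, he, lp.norm_single (by norm_num), norm_one, mul_one]
  have h := (homogeneousPart A m W).le_opNorm
    ((x ⊗ₜ[ℂ] e : K ⊗[ℂ] EllTwo (MultiWord n)) : HilbertTensor K (EllTwo (MultiWord n)))
  rw [happ, UniformSpace.Completion.norm_coe, UniformSpace.Completion.norm_coe, hnorm] at h
  have h2 := pow_le_pow_left₀ (norm_nonneg _) h 2
  rw [norm_sq_sum_tmul_single, mul_pow] at h2
  refine le_trans (le_of_eq (Finset.sum_congr rfl fun α _ => ?_)) h2
  rw [norm_smul, Complex.norm_real, mul_pow, Real.norm_of_nonneg (Real.sqrt_nonneg _),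
    Real.sq_sqrt (inv_nonneg.2 (Finset.prod_nonneg fun i _ => (hq i).weight_nonneg _))]

variable [CompleteSpace K]

/-- Λ_p is contained in Γ_m for m = |p|, and the other terms of the sum over Γ_m are nonnegative. -/
theorem IsWeightedCreation.sqrt_norm_weightedSquare_le (hq : ∀ i, IsPositiveRegular (q i))
    (hW : IsWeightedCreation q W) (A : MultiWord n → (K →L[ℂ] K)) (p : Fin k → ℕ) :
    √‖weightedSquare q A p‖ ≤ ‖homogeneousPart A (∑ i, p i) W‖ := by
  have hw : ∀ α : MultiWord n, 0 ≤ (∏ i, weight (q i) (α i))⁻¹ := fun α =>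
    inv_nonneg.2 (Finset.prod_nonneg fun i _ => (hq i).weight_nonneg _)
  refine Real.sqrt_le_iff.2 ⟨opNorm_nonneg _,
    norm_sum_smul_adjoint_mul_le _ hw A (sq_nonneg _) fun x => ?_⟩
  refine le_trans (Finset.sum_le_sum_of_subset_of_nonneg ?_ fun α _ _ =>
    mul_nonneg (hw α) (sq_nonneg _)) (hW.sum_totalDegree_le hq A _ x)
  intro α hα
  rw [mem_totalDegree]
  exact Finset.sum_congr rfl fun i _ => mem_multidegree.1 hα i

theorem finite_setOf_sum_lt (k M : ℕ) : {p : Fin k → ℕ | ∑ i, p i < M}.Finite := by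
  refine (Set.Finite.pi' fun _ => Set.finite_lt_nat M).subset fun p hp i => ?_
  exact (Finset.single_le_sum (fun _ _ => Nat.zero_le _) (Finset.mem_univ i)).trans_lt hp

theorem frequently_one_lt_pow_mul_sqrt (A : MultiWord n → (K →L[ℂ] K)) (s : ℝ≥0)
    (hs : radius q A < s) :
    ∃ᶠ p : Fin k → ℕ in cofinite, 1 < (s : ℝ) ^ (∑ i, p i) * √‖weightedSquare q A p‖ := by
  have hs0 : 0 < s := by exact_mod_cast (zero_le).trans_lt hs
  have hfreq := frequently_lt_of_lt_limsup (by isBoundedDefault) (ENNReal.inv_lt_iff_inv_lt.1 hs)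
  have hne : ∀ᶠ p : Fin k → ℕ in cofinite, p ≠ 0 := (Set.finite_singleton 0).compl_mem_cofinite
  refine (hfreq.and_eventually hne).mono fun p ⟨hp, hp0⟩ => ?_
  set t := ∑ i, p i with ht
  have ht0 : t ≠ 0 := fun h => hp0 (funext fun i =>
    (Finset.sum_eq_zero_iff.1 (ht.symm.trans h)) i (Finset.mem_univ i))
  have h1 : (s : ℝ)⁻¹ < ‖weightedSquare q A p‖ ^ (1 / (2 * (t : ℝ))) := by
    rw [← ENNReal.coe_inv hs0.ne', ← ENNReal.ofReal_coe_nnreal] at hp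
    exact_mod_cast (ENNReal.ofReal_lt_ofReal_iff_of_nonneg (by positivity)).1 hp
  have h2 : √‖weightedSquare q A p‖ = (‖weightedSquare q A p‖ ^ (1 / (2 * (t : ℝ)))) ^ t := by
    rw [← Real.rpow_natCast, ← Real.rpow_mul (norm_nonneg _), Real.sqrt_eq_rpow]
    congr 1
    have : (t : ℝ) ≠ 0 := by exact_mod_cast ht0
    field_simp
  have hs0' : (0 : ℝ) < s := by exact_mod_cast hs0
  rw [h2, ← mul_pow]
  refine one_lt_pow₀ ?_ ht0
  rwa [inv_lt_iff_one_lt_mul₀' hs0'] at h1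

omit [CompleteSpace K] in
theorem opNorm_smul (c : ℂ) (T : K →L[ℂ] K) : ‖c • T‖ = ‖c‖ * ‖T‖ :=
  norm_smul c T

theorem IsWeightedCreation.not_exists_tendsto (hq : ∀ i, IsPositiveRegular (q i))
    (hW : IsWeightedCreation q W) (A : MultiWord n → (K →L[ℂ] K)) (s : ℝ≥0)
    (hs : radius q A < s) :
    ¬ ∃ T : HilbertTensor K (EllTwo (MultiWord n)) →L[ℂ] HilbertTensor K (EllTwo (MultiWord n)),
      Tendsto (fun N : ℕ => ∑ m ∈ Finset.range N, homogeneousPart A m (((s : ℝ) : ℂ) • W))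
        atTop (𝓝 T) := by
  rintro ⟨T, hT⟩
  have h0 : Tendsto (fun m => homogeneousPart A m (((s : ℝ) : ℂ) • W)) atTop (𝓝 0) := by
    have h := (hT.comp (tendsto_add_atTop_nat 1)).sub hT
    rw [sub_self] at h
    refine h.congr fun m => ?_
    rw [Function.comp_apply, Finset.sum_range_succ, add_sub_cancel_left]
  have h1 := ((tendsto_zero_iff_norm_tendsto_zero (E := HilbertTensor K (EllTwo (MultiWord n)) →L[ℂ]
    HilbertTensor K (EllTwo (MultiWord n)))).1 h0).eventually_lt_const one_pos
  obtain ⟨M, hM⟩ := eventually_atTop.1 h1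
  -- Only finitely many p have total degree below M, so one of the infinitely many large terms lies
  -- beyond it.
  obtain ⟨p, hp, hpM⟩ := ((frequently_one_lt_pow_mul_sqrt A s hs).and_eventually
    (finite_setOf_sum_lt k M).compl_mem_cofinite).exists
  have h2 := hM (∑ i, p i) (not_lt.1 hpM)
  rw [homogeneousPart_smul, opNorm_smul, norm_pow, Complex.norm_real, NNReal.norm_eq] at h2
  refine lt_irrefl _ (hp.trans (lt_of_le_of_lt ?_ h2))
  exact mul_le_mul_of_nonneg_left (hW.sqrt_norm_weightedSquare_le hq A p) (by positivity)

end Model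

end

end Polydomain

theorem mainTheorem12 {k : ℕ} (n : Fin k → ℕ) (q : ∀ i, Polydomain.NCPoly (n i))
    (hq : ∀ i, Polydomain.IsPositiveRegular (q i))
    {K : Type*} [NormedAddCommGroup K] [InnerProductSpace ℂ K] [CompleteSpace K]
    (A : Polydomain.MultiWord n → (K →L[ℂ] K)) :
    (∀ (H : Type*) [NormedAddCommGroup H] [InnerProductSpace ℂ H] [CompleteSpace H] (r : ℝ≥0),
      (r : ℝ≥0∞) < Polydomain.radius q A →
      TendstoUniformlyOn
        (fun (N : ℕ) (X : Polydomain.OpTuple n H) =>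
          ∑ m ∈ Finset.range N, ‖Polydomain.homogeneousPart A m X‖)
        (fun X => ∑' m, ‖Polydomain.homogeneousPart A m X‖) atTop
        (((r : ℝ) : ℂ) • Polydomain.closedPolydomain q H)) ∧
    (∀ s : ℝ≥0, Polydomain.radius q A < (s : ℝ≥0∞) →
      ∃ (H : Type) (_ : NormedAddCommGroup H) (_ : InnerProductSpace ℂ H) (_ : CompleteSpace H),
        ∃ Y ∈ ((s : ℝ) : ℂ) • Polydomain.closedPolydomain q H,
          ¬ ∃ T : Polydomain.HilbertTensor K H →L[ℂ] Polydomain.HilbertTensor K H,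
            Tendsto (fun N : ℕ => ∑ m ∈ Finset.range N, Polydomain.homogeneousPart A m Y)
              atTop (𝓝 T)) := by
  refine ⟨fun H _ _ _ r hr => Polydomain.tendstoUniformlyOn_sum_norm_homogeneousPart hq A r hr,
    fun s hs => ?_⟩
  obtain ⟨W, hW⟩ := Polydomain.exists_isWeightedCreation hq
  exact ⟨Polydomain.EllTwo (Polydomain.MultiWord n), inferInstance, inferInstance, inferInstance,
    ((s : ℝ) : ℂ) • W, Set.smul_mem_smul_set (hW.mem_closedPolydomain hq),
    hW.not_exists_tendsto hq A s hs⟩
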